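/- Let $d,J\ge 1$, let $\Omega\subset\mathbb R^d$ be a bounded open set, let $M$ be a real $J\times J$ matrix with $Mx\cdot x>0$ for all $x\neq0$, and let $f:\mathbb R^J\to\mathbb R^J$ be $C^1$ with $$(f(x)-f(y))\cdot(x-y)\ \ge\ \alpha|x-y|^q+\tau(y)|x-y|^2,\qquad (df(x)y)\cdot y\ge-\mu_0|y|^2\qquad\forall x,y\in\mathbb R^J,$$ for some $\alpha\ge 0$, $q\ge1$, $\mu_0\ge0$ and some continuous $\tau:\mathbb R^J\to\mathbb R$. Let $s(t)\in L^2(\Omega;\mathbb R^J)$ for each time $t$ (a source given only for $0<t<T$ is extended arbitrarily, e.g. by zero), let $u_0\in H^1_0(\Omega;\mathbb R^J)$, and let $S_h$ be a finite-dimensional subspace of $H^1_0(\Omega;\mathbb R^J)$ with a basis $\phi_1,\dots,\phi_{N_h}$ of continuous functions that are, on each cell of a mesh of $\Omega$, polynomials of degree at most $r$. Write $(\cdot,\cdot)$ for the $L^2(\Omega)$ inner product, and $R_hu_0\in S_h$ for the elliptic projection: $(M\nabla(R_hu_0-u_0),\nabla\phi)=0$ for all $\phi\in S_h$. For a time step $k>0$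 and a sequence $(v^n)$ put $t_{n+1/2}=(n+\tfrac12)k$, $Dv^{n+1/2}=(v^{n+1}-v^n)/k$, $Ev^{n+1/2}=(v^{n+1}+v^n)/2$ and, with $\nu$ standing for $n$ or $n+\tfrac12$, $$\Lambda^jv^\nu=\sum_{i=1}^j\sum_{l=0}^{2i}c_{2i+1}(-1)^l\binom{2i}{l}v^{\nu+i-l},\qquad \Gamma^jv^\nu=\sum_{i=1}^j\sum_{l=0}^{2i}c_{2i}(-1)^l\binom{2i}{l}v^{\nu+i-l},$$ where $c_{2i}=(-1)^{i+1}16^{-i}\binom{2i}{i}$ and $c_{2i+1}=c_{2i}/(2i+1)$ (so $\Lambda^0=\Gamma^0=0$). The scheme DC$(2j+2)$, $j\ge0$, with time step $k$ asks for $u_h^{2j+2,n}\in S_h$ with $u_h^{2j+2,0}=R_hu_0$ and, for all $n\ge j$ and all $\phi\in S_h$, $$\big(Du_h^{2j+2,n+1/2}-\Lambda^jDu_h^{2j,n+1/2},\phi\big)+\big(M\nabla Y,\nabla\phi\big)+\big(f(Y),\phi\big)=\big(s(t_{n+1/2}),\phi\big),\quad Y=Eu_h^{2j+2,n+1/2}-\Gamma^jEu_h^{2j,n+1/2},$$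 while for $0\le n\le j-1$ the same equation holds with the two correction terms $\Lambda^jDu_h^{2j,n+1/2}$ and $\Gamma^jEu_h^{2j,n+1/2}$ replaced by $$\frac1k\sum_{i=1}^j\sum_{l=0}^{2i+1}c^j_{2i+1}(-1)^l\binom{2i+1}{l}\bar u_h^{2j,n_j+i-l+1}\quad\text{and}\quad \sum_{i=1}^j\sum_{l=0}^{2i}c^j_{2i}(-1)^l\binom{2i}{l}\,E\bar u_h^{2j,n_j+i-l+1/2},$$ where $n_j=(2j+1)n+j$, $c^j_{2i}=\binom{j+i}{2i}+c_{2i}$, $c^j_{2i+1}=(2j+1)\big(\tfrac1{2i+1}\binom{j+i}{2i}+c_{2i+1}\big)$, and $(\bar u_h^{2j,n})_n$ is a solution of DC$(2j)$ (obtained by the same recursive construction) with time step $k/(2j+1)$ in place of $k$. If $k|\tau(0)|<2$, then there are sequences $(u_h^{2j,n})_{n\ge0}$, $j=1,2,\dots$, in $S_h$ (that is, of the form $\sum_{l}U_l\phi_l$ with $U_l\in\mathbb R$) such that for every $j\ge1$ the sequence $(u_h^{2j,n})_n$ solves DC$(2j)$ with time step $k$, built on $(u_h^{2j-2,n})_n$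 if $j\ge2$; in particular this holds for the terms with $0\le n\le N$, for any $N$. -/

import Mathlib

open MeasureTheory
open scoped ContDiff Matrix

noncomputable section

namespace DCGalerkin

/-- Euclidean space `ℝⁿ`. -/
abbrev E (n : ℕ) : Type := EuclideanSpace ℝ (Fin n)

/-! ### The spaces `L²(Ω; ℝ^J)` and `H¹₀(Ω; ℝ^J)` -/

/-- `L²(Ω; ℝ^J)`. -/
abbrev L2 {d : ℕ} (Ω : Set (E d)) (J : ℕ) : Type :=
  Lp (E J) 2 (volume.restrict Ω)

/-- The pairs `(ψ, (∂₁ψ, …, ∂_dψ))` in `L² × (L²)^d`, for `ψ ∈ C_c^∞(Ω; ℝ^J)`. -/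
def testPairs {d : ℕ} (Ω : Set (E d)) (J : ℕ) :
    Submodule ℝ (L2 Ω J × (Fin d → L2 Ω J)) where
  carrier := {p | ∃ ψ : E d → E J, ContDiff ℝ ∞ ψ ∧ HasCompactSupport ψ ∧ tsupport ψ ⊆ Ω ∧
    (p.1 : E d → E J) =ᵐ[volume.restrict Ω] ψ ∧
    ∀ i, (p.2 i : E d → E J) =ᵐ[volume.restrict Ω]
      fun x => fderiv ℝ ψ x (EuclideanSpace.single i 1)}
  zero_mem' := by
    refine ⟨0, contDiff_const, HasCompactSupport.zero, by simp [tsupport], Lp.coeFn_zero _ _ _,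
      fun i => ?_⟩
    refine (Lp.coeFn_zero _ _ _).trans (Filter.Eventually.of_forall fun x => ?_)
    simp
  add_mem' := by
    rintro a b ⟨ψ, h1, h2, h3, h4, h5⟩ ⟨χ, g1, g2, g3, g4, g5⟩
    refine ⟨ψ + χ, h1.add g1, h2.add g2, ?_, (Lp.coeFn_add _ _).trans (h4.add g4), fun i => ?_⟩
    · exact (tsupport_add ψ χ).trans (Set.union_subset h3 g3)
    · refine ((Lp.coeFn_add (a.2 i) (b.2 i)).trans ((h5 i).add (g5 i))).trans
        (Filter.Eventually.of_forall fun x => ?_)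
      have := fderiv_add (h1.differentiable (by simp) x) (g1.differentiable (by simp) x)
      simp [this]
  smul_mem' := by
    rintro c a ⟨ψ, h1, h2, h3, h4, h5⟩
    refine ⟨c • ψ, h1.const_smul c, h2.smul_left (f := fun _ => c), ?_,
      (Lp.coeFn_smul c _).trans (h4.const_smul c), fun i => ?_⟩
    · exact (tsupport_smul_subset_right (fun _ => c) ψ).trans h3
    · refine ((Lp.coeFn_smul c (a.2 i)).trans ((h5 i).const_smul c)).trans
        (Filter.Eventually.of_forall fun x => ?_)
      have := fderiv_const_smul (h1.differentiable (by simp) x) c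
      simp [this]

/-- `H¹₀(Ω; ℝ^J)`, the closure of `C_c^∞(Ω; ℝ^J)` in the `H¹` norm.
An element is the pair `(v, (∂₁v, …, ∂_dv))` of a function and its weak partial derivatives. -/
def H10 {d : ℕ} (Ω : Set (E d)) (J : ℕ) : Submodule ℝ (L2 Ω J × (Fin d → L2 Ω J)) :=
  (testPairs Ω J).topologicalClosure

variable {d J : ℕ} {Ω : Set (E d)}

/-- The function underlying an element of `H¹₀(Ω; ℝ^J)`. -/
def fn (v : H10 Ω J) : L2 Ω J := v.1.1

/-- The weak partial derivative `∂ᵢ v` of an element of `H¹₀(Ω; ℝ^J)`. -/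
def pderiv (v : H10 Ω J) (i : Fin d) : L2 Ω J := v.1.2 i

/-- The inner product `(v, w)` of `L²(Ω; ℝ^J)`. -/
def pairing (v w : E d → E J) (Ω : Set (E d)) : ℝ :=
  ∫ x in Ω, inner ℝ (v x) (w x)

/-- The bilinear form `(M∇v, ∇w) = ∑ᵢ ∫_Ω (M ∂ᵢv) · ∂ᵢw`. -/
def energy (M : Matrix (Fin J) (Fin J) ℝ) (v w : H10 Ω J) : ℝ :=
  ∑ i, pairing (fun x => Matrix.toEuclideanCLM (𝕜 := ℝ) M (pderiv v i x)) (pderiv w i) Ω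

/-! ### Finite elements -/

/-- A mesh of `Ω`: finitely many compact connected cells with nonempty interior, with pairwise
disjoint interiors, whose union is the closure of `Ω`. -/
structure IsMesh (Ω : Set (E d)) (𝒯 : Set (Set (E d))) : Prop where
  finite : 𝒯.Finite
  isCompact : ∀ K ∈ 𝒯, IsCompact K
  isConnected : ∀ K ∈ 𝒯, IsConnected K
  interior_nonempty : ∀ K ∈ 𝒯, (interior K).Nonempty
  disjoint : ∀ K ∈ 𝒯, ∀ L ∈ 𝒯, K ≠ L → Disjoint (interior K) (interior L)
  sUnion_eq : ⋃₀ 𝒯 = closure Ω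

/-- `v` is (a.e. equal to) a continuous function on the closure of `Ω` whose components are, on
each cell of `𝒯`, polynomials of degree at most `r`. -/
def IsContinuousPiecewisePolynomial (𝒯 : Set (Set (E d))) (r : ℕ) (v : H10 Ω J) : Prop :=
  ∃ g : E d → E J, ContinuousOn g (closure Ω) ∧
    (∀ K ∈ 𝒯, ∀ i : Fin J, ∃ P : MvPolynomial (Fin d) ℝ, P.totalDegree ≤ r ∧
      ∀ x ∈ K, g x i = MvPolynomial.eval (fun l => x l) P) ∧
    (fn v : E d → E J) =ᵐ[volume.restrict Ω] g

/-! ### Coefficients of the finite difference formulas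

With `δ = 2 sinh(κ∂/2)`, the central formulas are the expansions
`(1 + δ²/4)^(-1/2) = 1 - ∑ c_{2i} δ^{2i}` and `2 arsinh(δ/2) = δ - ∑ c_{2i+1} δ^{2i+1}`.
The interior formulas, on the `2p+2` points of a uniform subdivision, come from the same
expansions with `cosh((2p+1)y) / cosh y = ∑ C(p+i, 2i) δ^{2i}` and
`2 sinh((2p+1)y) = ∑ (2p+1)/(2i+1) C(p+i, 2i) δ^{2i+1}`, where `δ = 2 sinh y`. -/

/-- `c_{2i}`: `c₂ = 1/8`, `c₄ = -3/128`, `c₆ = 5/1024`, … -/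
def cEven (i : ℕ) : ℝ := (-1) ^ (i + 1) * ((2 * i).choose i : ℝ) / 16 ^ i

/-- `c_{2i+1}`: `c₃ = 1/24`, `c₅ = -3/640`, `c₇ = 5/7168`, … -/
def cOdd (i : ℕ) : ℝ := cEven i / (2 * i + 1)

/-- `c^p_{2i}` (`1 ≤ i ≤ p`): `c¹₂ = 9/8`, `c²₂ = 25/8`, `c²₄ = 125/128`, … -/
def cIntEven (p i : ℕ) : ℝ := ((p + i).choose (2 * i) : ℝ) + cEven i

/-- `c^p_{2i+1}` (`1 ≤ i ≤ p`): `c¹₃ = 9/8`, `c²₃ = 125/24`, `c²₅ = 125/128`, … -/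
def cIntOdd (p i : ℕ) : ℝ :=
  (2 * p + 1) * (((p + i).choose (2 * i) : ℝ) / (2 * i + 1) + cOdd i)

/-! ### Finite difference operators on sequences

A sequence `w` of values at the points `t_n`, or at the points `t_{n+1/2}`, is indexed by `n`. -/

section FiniteDifferences

variable {V : Type*} [AddCommGroup V] [Module ℝ V]

/-- `D u^{n+1/2} = (u^{n+1} - u^n) / k`. -/
def fdD (k : ℝ) (u : ℕ → V) (n : ℕ) : V := k⁻¹ • (u (n + 1) - u n)

/-- `E u^{n+1/2} = (u^{n+1} + u^n) / 2`. -/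
def fdE (u : ℕ → V) (n : ℕ) : V := (2 : ℝ)⁻¹ • (u (n + 1) + u n)

/-- `Λ^j w`, for `n ≥ j`. -/
def fdΛ (j : ℕ) (w : ℕ → V) (n : ℕ) : V :=
  ∑ i ∈ Finset.Icc 1 j, ∑ l ∈ Finset.range (2 * i + 1),
    (cOdd i * (-1) ^ l * ((2 * i).choose l : ℝ)) • w (n + i - l)

/-- `Γ^j w`, for `n ≥ j`. -/
def fdΓ (j : ℕ) (w : ℕ → V) (n : ℕ) : V :=
  ∑ i ∈ Finset.Icc 1 j, ∑ l ∈ Finset.range (2 * i + 1),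
    (cEven i * (-1) ^ l * ((2 * i).choose l : ℝ)) • w (n + i - l)

/-- `(1/(2j+1)) Λ̄^j D ū^{m+1/2}`, for `m ≥ j`; here `k` is the coarse time step while `ū` lives on
the grid of step `k/(2j+1)`. -/
def fdΛBarD (k : ℝ) (j : ℕ) (w : ℕ → V) (m : ℕ) : V :=
  k⁻¹ • ∑ i ∈ Finset.Icc 1 j, ∑ l ∈ Finset.range (2 * i + 2),
    (cIntOdd j i * (-1) ^ l * ((2 * i + 1).choose l : ℝ)) • w (m + i + 1 - l)

/-- `Γ̄^j w`, for `m ≥ j`. -/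
def fdΓBar (j : ℕ) (w : ℕ → V) (m : ℕ) : V :=
  ∑ i ∈ Finset.Icc 1 j, ∑ l ∈ Finset.range (2 * i + 1),
    (cIntEven j i * (-1) ^ l * ((2 * i).choose l : ℝ)) • w (m + i - l)

end FiniteDifferences

/-! ### The fully discrete deferred correction scheme -/

section Scheme

variable (M : Matrix (Fin J) (Fin J) ℝ) (f : E J → E J) (s : ℝ → L2 Ω J) (u₀ : H10 Ω J)
  (Sh : Submodule ℝ (H10 Ω J))

/-- `w = R_h u₀`: the projection of `u₀` onto `S_h` for the form `(M∇·, ∇·)`. -/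
def IsEllipticProjection (w : Sh) : Prop :=
  ∀ φ : Sh, energy M ((w : H10 Ω J) - u₀) φ = 0

/-- `(X, φ) + (M∇Y, ∇φ) + (f(Y), φ) = (s(t), φ)` for all `φ ∈ S_h`. -/
def GalerkinEq (t : ℝ) (X Y : Sh) : Prop :=
  ∀ φ : Sh,
    pairing (fn X.1) (fn φ.1) Ω + energy M (Y : H10 Ω J) φ
      + pairing (fun x => f (fn Y.1 x)) (fn φ.1) Ω
    = pairing (s t) (fn φ.1) Ω

/-- Step `n ≥ j` of DC(2j+2) with time step `k`: `u` is `u_h^{2j+2}` and `v` is `u_h^{2j}`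
(not used if `j = 0`, the implicit midpoint rule). -/
def MainStep (k : ℝ) (j : ℕ) (v u : ℕ → Sh) (n : ℕ) : Prop :=
  GalerkinEq M f s Sh (((n : ℝ) + 1 / 2) * k)
    (fdD k u n - fdΛ j (fdD k v) n) (fdE u n - fdΓ j (fdE v) n)

/-- Starting step `n < j` of DC(2j+2) with time step `k`: `u` is `u_h^{2j+2}` and `w` is `ū_h^{2j}`,
on the grid of step `k/(2j+1)`; it is used around the index `n_j = (2j+1)n + j`. -/
def StartStep (k : ℝ) (j : ℕ) (w u : ℕ → Sh) (n : ℕ) : Prop :=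
  GalerkinEq M f s Sh (((n : ℝ) + 1 / 2) * k)
    (fdD k u n - fdΛBarD k j w ((2 * j + 1) * n + j))
    (fdE u n - fdΓBar j (fdE w) ((2 * j + 1) * n + j))

/-- `IsDCSolution M f s u₀ Sh p k u`: for `1 ≤ j ≤ p`, the sequence `u j = (u_h^{2j,n})_n` solves
DC(2j) with time step `k`, each correction using the preceding sequence and, for its starting
values, a solution of the preceding schemes with time step `k/(2j+1)`. -/
def IsDCSolution : ℕ → ℝ → (ℕ → ℕ → Sh) → Prop
  | 0, _, _ => True
  | j + 1, k, u =>
      IsDCSolution j k u ∧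
      IsEllipticProjection M u₀ Sh (u (j + 1) 0) ∧
      (∀ n, j ≤ n → MainStep M f s Sh k j (u j) (u (j + 1)) n) ∧
      ∃ w : ℕ → ℕ → Sh, IsDCSolution j (k / (2 * j + 1)) w ∧
        ∀ n, n < j → StartStep M f s Sh k j (w j) (u (j + 1)) n

end Scheme

end DCGalerkin

end

/-! Each time step is a nonlinear equation in the finite-dimensional space `Sh`. With the argument
`Y` of `f` as the unknown, the difference quotient is `(2/k) Y` plus known data, so the equation
reads `(2/k)(Y, φ) + (M∇Y, ∇φ) + (f(Y), φ) = data`. The monotonicity hypothesis at `y = 0` gives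
`(f(x) - f(0))·x ≥ -|τ(0)||x|²`. When `2/k > |τ(0)|`, the equation tested with `Y` is therefore
bounded below by a positive definite quadratic form plus a linear functional, and the associated
vector field points outwards on large spheres. Such a field has a zero
(`exists_eq_zero_of_inner_pos`), which gives `exists_implicit_step` and `exists_galerkinEq`.

The topological input is proved by integration, in the manner of Milnor and Rogers: the
change-of-variables integral for `x + t h(x)` is polynomial in `t` and constant for small `t`, hence
constant up to `t = 1` (`setIntegral_comp_mul_det_eq`); a nowhere vanishing `x + h(x)` would
contradict this (`exists_add_eq_zero_of_contDiff`).

Solvable steps chain into sequences, starting from the elliptic projection. The starting values need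
the previous order with step `k/(2j+1) ≤ k`, for which the smallness condition persists, so
induction on the order closes (`exists_isDCSolution`, `exists_forall_isDCSolution`). -/

noncomputable section

namespace DCGalerkin

/-! ### Zeros of coercive vector fields -/

section Zeros

open Polynomial in
-- Interpolation at `N + 1` nodes in the interval has weights independent of `x` and summing to one,
-- so it passes through the integral.
lemma integral_eq_of_polynomial_of_eq_on_Ioo {α : Type*} [MeasurableSpace α] {μ : Measure α}
    {F : ℝ → α → ℝ} {N : ℕ} {t₀ c : ℝ} (ht₀ : 0 < t₀)
    (hF : ∀ x, ∃ p : ℝ[X], p.natDegree ≤ N ∧ ∀ t, p.eval t = F t x)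
    (hint : ∀ t, Integrable (F t) μ) (hc : ∀ t ∈ Set.Ioo 0 t₀, ∫ x, F t x ∂μ = c) (t : ℝ) :
    ∫ x, F t x ∂μ = c := by
  obtain ⟨v, hv, hinj⟩ : ∃ v : ℕ → ℝ, (∀ i, v i ∈ Set.Ioo 0 t₀) ∧ Function.Injective v := by
    -- The shift by `2` keeps the node `i = 0` strictly below `t₀`.
    refine ⟨fun i => t₀ / (i + 2), fun i => ⟨by positivity, ?_⟩, fun i j hij => ?_⟩
    · rw [div_lt_iff₀ (by positivity)]
      have : (0 : ℝ) ≤ i := by positivity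
      nlinarith
    · have hi : (i : ℝ) + 2 ≠ 0 := by positivity
      have hj : (j : ℝ) + 2 ≠ 0 := by positivity
      simp only at hij
      field_simp at hij
      exact_mod_cast (add_right_cancel hij).symm
  set S := Finset.range (N + 1)
  have hvS : Set.InjOn v S := hinj.injOn
  have key : ∀ x, F t x = ∑ i ∈ S, F (v i) x * (Lagrange.basis S v i).eval t := by
    intro x
    obtain ⟨p, hp, hpF⟩ := hF x
    have hdeg : p.degree < S.card := by
      refine lt_of_le_of_lt degree_le_natDegree ?_
      rw [Finset.card_range]
      exact_mod_cast Nat.lt_succ_of_le hp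
    have := congrArg (eval t) (Lagrange.eq_interpolate hvS hdeg)
    rw [hpF, Lagrange.interpolate_apply, eval_finsetSum] at this
    simpa only [eval_mul, eval_C, hpF] using this
  have hone : ∑ i ∈ S, (Lagrange.basis S v i).eval t = 1 := by
    rw [← eval_finsetSum, Lagrange.sum_basis hvS ⟨0, by simp [S]⟩, eval_one]
  simp_rw [key]
  rw [integral_finsetSum _ fun i _ => (hint (v i)).mul_const _]
  simp_rw [integral_mul_const, hc _ (hv _)]
  rw [← Finset.mul_sum, hone, mul_one]

variable {V : Type*} [NormedAddCommGroup V] [InnerProductSpace ℝ V]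

open Polynomial in
lemma exists_polynomial_eval_eq_sub_norm_sq_pow (c : ℝ) (m : ℕ) (x y : V) :
    ∃ p : ℝ[X], p.natDegree ≤ 2 * m ∧ ∀ t : ℝ, p.eval t = (c - ‖x + t • y‖ ^ 2) ^ m := by
  refine ⟨(C (-‖y‖ ^ 2) * X ^ 2 + C (-2 * inner ℝ x y) * X + C (c - ‖x‖ ^ 2)) ^ m, ?_, fun t => ?_⟩
  · rw [mul_comm 2 m]
    exact natDegree_pow_le_of_le m (natDegree_quadratic_le)
  · rw [norm_add_sq_real, norm_smul, inner_smul_right, mul_pow, Real.norm_eq_abs, sq_abs]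
    simp only [eval_pow, eval_add, eval_mul, eval_C, eval_X]
    ring

variable [FiniteDimensional ℝ V]

open Polynomial in
lemma exists_polynomial_eval_eq_det (A : V →L[ℝ] V) :
    ∃ p : ℝ[X], p.natDegree ≤ Module.finrank ℝ V ∧
      ∀ t : ℝ, p.eval t = (ContinuousLinearMap.id ℝ V + t • A).det := by
  let b := Module.finBasis ℝ V
  let A' := LinearMap.toMatrix b b (A : V →ₗ[ℝ] V)
  refine ⟨((X : ℝ[X]) • A'.map C + (1 : Matrix _ _ ℝ).map C).det, ?_, fun t => ?_⟩
  · simpa using natDegree_det_X_add_C_le A' 1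
  · rw [ContinuousLinearMap.det, ← LinearMap.det_toMatrix b, ← coe_evalRingHom, RingHom.map_det]
    congr 1
    ext i j
    simp [A', LinearMap.toMatrix_apply, Matrix.one_apply, b.repr_self, Finsupp.single_apply,
      apply_ite, eq_comm, add_comm]
    ring

variable [MeasurableSpace V] [BorelSpace V]

/-- For small `t`, `x + t h(x)` is a bijection of the ball with positive Jacobian, so the identity
is a change of variables. The integrand is polynomial in `t`, which carries it to `t = 1`, where
neither property need hold. -/
lemma setIntegral_comp_mul_det_eq {h : V → V} (hh : ContDiff ℝ 1 h) {R : ℝ}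
    (hsupp : ∀ x, R < ‖x‖ → h x = 0) (c : ℝ) (m : ℕ) :
    ∫ x in Metric.closedBall (0 : V) R, (c - ‖x + h x‖ ^ 2) ^ m *
        (ContinuousLinearMap.id ℝ V + fderiv ℝ h x).det
      = ∫ x in Metric.closedBall (0 : V) R, (c - ‖x‖ ^ 2) ^ m := by
  have hcs : HasCompactSupport h :=
    HasCompactSupport.intro (isCompact_closedBall (0 : V) R) fun x hx => hsupp x (by simpa using hx)
  obtain ⟨L, hL⟩ := hh.lipschitzWith_of_hasCompactSupport hcs one_ne_zero
  have hcont : Continuous (fderiv ℝ h) := hh.continuous_fderiv one_ne_zero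
  have hdet : Continuous fun A : V →L[ℝ] V => A.det := ContinuousLinearMap.continuous_det
  have hfL : ∀ x, ‖fderiv ℝ h x‖ ≤ L := fun x => norm_fderiv_le_of_lipschitz ℝ hL
  obtain ⟨ε, hε, hpos⟩ : ∃ ε > 0, ∀ A : V →L[ℝ] V, ‖A‖ < ε →
      0 < (ContinuousLinearMap.id ℝ V + A).det := by
    have : ∀ᶠ A in nhds (0 : V →L[ℝ] V), 0 < (ContinuousLinearMap.id ℝ V + A).det := by
      refine (hdet.comp (continuous_const.add continuous_id)).continuousAt.eventually_const_lt ?_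
      simp [ContinuousLinearMap.det]
    obtain ⟨ε, hε, h⟩ := Metric.eventually_nhds_iff.1 this
    exact ⟨ε, hε, fun A hA => h (by simpa using hA)⟩
  -- Below this `t₀`, `t L < 1` gives bijectivity and `t L < ε` a positive determinant; `L + 1`
  -- avoids dividing by zero.
  have main := integral_eq_of_polynomial_of_eq_on_Ioo
    (μ := volume.restrict (Metric.closedBall (0 : V) R))
    (F := fun t x => (c - ‖x + t • h x‖ ^ 2) ^ m *
      (ContinuousLinearMap.id ℝ V + t • fderiv ℝ h x).det)
    (N := 2 * m + Module.finrank ℝ V) (t₀ := min 1 ε / (L + 1))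
    (c := ∫ x in Metric.closedBall (0 : V) R, (c - ‖x‖ ^ 2) ^ m) (by positivity) ?_ ?_ ?_ 1
  · simpa using main
  · intro x
    obtain ⟨p, hp, hpe⟩ := exists_polynomial_eval_eq_sub_norm_sq_pow c m x (h x)
    obtain ⟨p', hp', hpe'⟩ := exists_polynomial_eval_eq_det (fderiv ℝ h x)
    refine ⟨p * p', Polynomial.natDegree_mul_le.trans (add_le_add hp hp'), fun t => ?_⟩
    rw [Polynomial.eval_mul, hpe, hpe']
  · intro t
    refine ContinuousOn.integrableOn_compact (isCompact_closedBall _ _) (Continuous.continuousOn ?_)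
    have := hh.continuous
    exact (by fun_prop : Continuous fun x => (c - ‖x + t • h x‖ ^ 2) ^ m).mul
      (hdet.comp (continuous_const.add (hcont.const_smul t)))
  · rintro t ⟨ht0, ht1⟩
    have hL1 : (0 : ℝ) < L + 1 := by positivity
    rw [lt_div_iff₀ hL1] at ht1
    have htL : t * L < min 1 ε := by nlinarith
    let g : V → V := fun x => x + t • h x
    have hg : ApproximatesLinearOn g ((ContinuousLinearEquiv.refl ℝ V : V ≃L[ℝ] V) : V →L[ℝ] V)
        Set.univ (‖t‖₊ * L) := by
      rw [ApproximatesLinearOn.approximatesLinearOn_iff_lipschitzOnWith, lipschitzOnWith_univ]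
      convert! (lipschitzWith_smul t).comp hL using 1
      ext x
      simp [g]
    have hc' : Subsingleton V ∨ ‖t‖₊ * L <
        ‖((ContinuousLinearEquiv.refl ℝ V).symm : V →L[ℝ] V)‖₊⁻¹ := by
      rcases subsingleton_or_nontrivial V with hV | hV
      · exact Or.inl hV
      · right
        have : ‖((ContinuousLinearEquiv.refl ℝ V).symm : V →L[ℝ] V)‖₊ = 1 := by
          ext; simp
        rw [this, inv_one, ← NNReal.coe_lt_coe]
        simpa [abs_of_pos ht0] using htL.trans_le (min_le_left _ _)
    have hinj : Function.Injective g := Set.injOn_univ.1 (hg.injOn hc')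
    have hsurj : Function.Surjective g := hg.surjective hc'
    have hout : ∀ x, R < ‖x‖ → g x = x := fun x hx => by simp [g, hsupp x hx]
    -- A bijection of `V` fixing every point outside the ball maps the ball onto itself.
    have himage : g '' Metric.closedBall 0 R = Metric.closedBall 0 R := by
      apply Set.Subset.antisymm
      · rintro _ ⟨x, hx, rfl⟩
        by_contra hgx
        have h1 : R < ‖g x‖ := by simpa using hgx
        have h2 := hinj (hout _ h1)
        rw [h2] at h1
        exact absurd h1 (by simpa using hx)
      · intro y hy
        obtain ⟨x, rfl⟩ := hsurj y
        refine ⟨x, ?_, rfl⟩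
        by_contra hx
        rw [hout x (by simpa using hx)] at hy
        exact hx hy
    have hderiv : ∀ x ∈ Metric.closedBall (0 : V) R, HasFDerivWithinAt g
        (ContinuousLinearMap.id ℝ V + t • fderiv ℝ h x) (Metric.closedBall 0 R) x := fun x _ =>
      ((hasFDerivAt_id x).add
        (((hh.differentiable one_ne_zero) x).hasFDerivAt.const_smul t)).hasFDerivWithinAt
    have hcv := integral_image_eq_integral_abs_det_fderiv_smul volume
      Metric.isClosed_closedBall.measurableSet hderiv hinj.injOn (fun y => (c - ‖y‖ ^ 2) ^ m)
    rw [himage] at hcv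
    rw [hcv]
    refine integral_congr_ae (Filter.Eventually.of_forall fun x => ?_)
    have : 0 < (ContinuousLinearMap.id ℝ V + t • fderiv ℝ h x).det := by
      refine hpos _ ?_
      rw [norm_smul, Real.norm_eq_abs, abs_of_pos ht0]
      exact (mul_le_mul_of_nonneg_left (hfL x) ht0.le).trans_lt (htL.trans_le (min_le_right _ _))
    simp only [abs_of_pos this, smul_eq_mul, g]
    ring

/-- A `C¹` map which is the identity outside a ball takes the value `0`. -/
lemma exists_add_eq_zero_of_contDiff {h : V → V} (hh : ContDiff ℝ 1 h) {R : ℝ} (hR : 0 < R)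
    (hsupp : ∀ x, R < ‖x‖ → h x = 0) : ∃ x, x + h x = 0 := by
  by_contra! hne
  set B := Metric.closedBall (0 : V) R
  have hB : IsCompact B := isCompact_closedBall _ _
  have hBne : B.Nonempty := ⟨0, by simp [B, hR.le]⟩
  have hcG : Continuous fun x => ‖x + h x‖ := (continuous_id.add hh.continuous).norm
  obtain ⟨x₀, -, hx₀⟩ := hB.exists_isMinOn hBne hcG.continuousOn
  obtain ⟨x₁, -, hx₁⟩ := hB.exists_isMaxOn hBne hcG.continuousOn
  have hcd : Continuous fun x => (ContinuousLinearMap.id ℝ V + fderiv ℝ h x).det :=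
    ContinuousLinearMap.continuous_det.comp
      (continuous_const.add (hh.continuous_fderiv one_ne_zero))
  obtain ⟨D, hD⟩ := hB.exists_bound_of_continuousOn hcd.continuousOn
  -- On the ball `|x + h(x)| ≥ δ`, while `|x| ≤ δ/2` on a set of positive volume. The constant `c`
  -- keeps `c - |x + h(x)|²` and `c - |x|²` nonnegative there. One side of the integral identity is
  -- then `O(b^m)`, the other at least a multiple of `a^m` with `b < a`.
  set δ := min ‖x₀ + h x₀‖ R
  have hδ : 0 < δ := lt_min (norm_pos_iff.2 (hne _)) hR
  set c := ‖x₁ + h x₁‖ ^ 2 + R ^ 2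
  have hδc : δ ^ 2 ≤ R ^ 2 := by gcongr; exact min_le_right _ _
  set a := c - (δ / 2) ^ 2
  set b := c - δ ^ 2
  have hb : 0 ≤ b := by
    have : 0 ≤ ‖x₁ + h x₁‖ ^ 2 := by positivity
    simp only [b, c]; linarith
  have hba : b < a := by simp only [a, b]; nlinarith
  have hv : 0 < volume.real (Metric.closedBall (0 : V) (δ / 2)) :=
    ENNReal.toReal_pos (Metric.measure_closedBall_pos _ _ (by positivity)).ne'
      (isCompact_closedBall _ _).measure_lt_top.ne
  have hle : ∀ m : ℕ, volume.real (Metric.closedBall (0 : V) (δ / 2)) * a ^ m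
      ≤ (D * volume.real B) * b ^ m := by
    intro m
    have hD0 : 0 ≤ D := (norm_nonneg _).trans (hD 0 (by simp [B, hR.le]))
    have hup : ‖∫ x in B, (c - ‖x + h x‖ ^ 2) ^ m *
        (ContinuousLinearMap.id ℝ V + fderiv ℝ h x).det‖ ≤ b ^ m * D * volume.real B := by
      refine norm_setIntegral_le_of_norm_le_const hB.measure_lt_top fun x hx => ?_
      rw [norm_mul]
      refine mul_le_mul ?_ (hD x hx) (norm_nonneg _) (by positivity)
      have h1 : ‖x + h x‖ ≤ ‖x₁ + h x₁‖ := hx₁ hx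
      have h0 : δ ≤ ‖x + h x‖ := (min_le_left _ _).trans (hx₀ hx)
      have h2 : 0 ≤ c - ‖x + h x‖ ^ 2 := by
        have : ‖x + h x‖ ^ 2 ≤ ‖x₁ + h x₁‖ ^ 2 := by gcongr
        simp only [c]; nlinarith
      rw [norm_pow, Real.norm_eq_abs, abs_of_nonneg h2]
      refine pow_le_pow_left₀ h2 ?_ m
      have : δ ^ 2 ≤ ‖x + h x‖ ^ 2 := by gcongr
      simp only [b]; linarith
    have hnn : ∀ x ∈ B, 0 ≤ (c - ‖x‖ ^ 2) ^ m := fun x hx => by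
      have h1 : ‖x‖ ≤ R := by simpa [B] using hx
      have : ‖x‖ ^ 2 ≤ R ^ 2 := by gcongr
      refine pow_nonneg ?_ m
      simp only [c]; nlinarith [sq_nonneg ‖x₁ + h x₁‖]
    have hi : IntegrableOn (fun x : V => (c - ‖x‖ ^ 2) ^ m) B :=
      ContinuousOn.integrableOn_compact hB (by fun_prop)
    have hsub : Metric.closedBall (0 : V) (δ / 2) ⊆ B :=
      Metric.closedBall_subset_closedBall (by linarith [min_le_right ‖x₀ + h x₀‖ R])
    have hlow : volume.real (Metric.closedBall (0 : V) (δ / 2)) * a ^ m ≤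
        ∫ x in B, (c - ‖x‖ ^ 2) ^ m := by
      calc volume.real (Metric.closedBall (0 : V) (δ / 2)) * a ^ m
          = ∫ x in Metric.closedBall (0 : V) (δ / 2), a ^ m := by
            rw [setIntegral_const, smul_eq_mul]
        _ ≤ ∫ x in Metric.closedBall (0 : V) (δ / 2), (c - ‖x‖ ^ 2) ^ m := by
            refine setIntegral_mono_on
              (integrableOn_const (isCompact_closedBall _ _).measure_lt_top.ne)
              (hi.mono_set hsub) Metric.isClosed_closedBall.measurableSet fun x hx => ?_
            have h1 : ‖x‖ ≤ δ / 2 := by simpa using hx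
            have : ‖x‖ ^ 2 ≤ (δ / 2) ^ 2 := by gcongr
            refine pow_le_pow_left₀ (hb.trans hba.le) ?_ m
            simp only [a]; linarith
        _ ≤ _ := by
            refine setIntegral_mono_set hi ?_ hsub.eventuallyLE
            exact (ae_restrict_mem Metric.isClosed_closedBall.measurableSet).mono hnn
    rw [setIntegral_comp_mul_det_eq hh hsupp] at hup
    calc _ ≤ _ := hlow
      _ ≤ _ := le_abs_self _
      _ ≤ _ := hup
      _ = _ := by ring
  have ha : 0 < a := hb.trans_lt hba
  have hlim : Filter.Tendsto (fun m : ℕ => (D * volume.real B) * (b / a) ^ m) Filter.atTop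
      (nhds ((D * volume.real B) * 0)) :=
    (tendsto_pow_atTop_nhds_zero_of_lt_one (by positivity)
      ((div_lt_one ha).2 hba)).const_mul _
  refine absurd (ge_of_tendsto' hlim (b := volume.real (Metric.closedBall (0 : V) (δ / 2)))
    fun m => ?_) (by simpa using hv)
  rw [div_pow, ← mul_div_assoc, le_div_iff₀ (by positivity)]
  exact hle m

/-- A continuous vector field pointing outwards outside a ball vanishes somewhere. -/
theorem exists_eq_zero_of_inner_pos {F : V → V} (hF : Continuous F) {R : ℝ} (hR : 0 < R)
    (hpos : ∀ x, R ≤ ‖x‖ → 0 < inner ℝ (F x) x) : ∃ x, F x = 0 := by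
  by_contra! hne
  have hB : IsCompact (Metric.closedBall (0 : V) (R + 1)) := isCompact_closedBall _ _
  obtain ⟨δ, hδ, hδF⟩ := hB.exists_forall_le' hF.norm.continuousOn (a := 0)
    fun x _ => norm_pos_iff.2 (hne x)
  obtain ⟨η, hη, hηF⟩ := (hB.inter_right (isClosed_le continuous_const continuous_norm :
    IsClosed {x : V | R ≤ ‖x‖})).exists_forall_le' (hF.inner continuous_id).continuousOn (a := 0)
    fun x hx => hpos x hx.2
  -- The tolerance `δ` keeps `G` nonzero on the ball of radius `R + 1`; `η / (R + 1)` keeps it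
  -- outward on the shell.
  obtain ⟨G, hG, hGF, -⟩ := hF.exists_contDiff_approx 1
    (continuous_const (y := min δ (η / (R + 1)))) fun _ => by positivity
  simp only [lt_min_iff] at hGF
  have hG0 : ∀ x, ‖x‖ ≤ R + 1 → G x ≠ 0 := fun x hxR hx => by
    have := (hGF x).1
    rw [hx, dist_zero_left] at this
    exact absurd this (not_lt.2 (hδF x (by simpa using hxR)))
  have hGpos : ∀ x, R ≤ ‖x‖ → ‖x‖ ≤ R + 1 → 0 < inner ℝ (G x) x := fun x hx hxR => by
    have h1 : inner ℝ (F x - G x) x ≤ ‖F x - G x‖ * ‖x‖ := real_inner_le_norm _ _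
    have h2 : ‖F x - G x‖ < η / (R + 1) := by
      rw [← dist_eq_norm, dist_comm]; exact (hGF x).2
    have h3 : η ≤ inner ℝ (F x) x := hηF x ⟨by simpa using hxR, hx⟩
    rw [lt_div_iff₀ (by positivity)] at h2
    have h4 : ‖F x - G x‖ * ‖x‖ ≤ ‖F x - G x‖ * (R + 1) := by gcongr
    rw [inner_sub_left] at h1
    linarith
  -- The glued field is `G` inside, the identity outside, and on the shell a convex combination of
  -- two outward fields.
  let χ : ContDiffBump (0 : V) := ⟨R, R + 1, hR, by linarith⟩
  obtain ⟨x, hx⟩ := exists_add_eq_zero_of_contDiff (h := fun x => χ x • (G x - x)) (R := R + 1)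
    (χ.contDiff.smul (hG.sub contDiff_id)) (by positivity)
    (fun x hx => by
      rw [χ.zero_of_le_dist (by simpa using hx.le), zero_smul])
  rcases le_total ‖x‖ R with h | h
  · rw [χ.one_of_mem_closedBall (by simpa using h)] at hx
    exact hG0 x (by linarith) (by simpa using hx)
  · have h1 : 0 < inner ℝ (x + χ x • (G x - x)) x := by
      have e : inner ℝ (x + χ x • (G x - x)) x
          = (1 - χ x) * ‖x‖ ^ 2 + χ x * inner ℝ (G x) x := by
        rw [inner_add_left, inner_smul_left, inner_sub_left, real_inner_self_eq_norm_sq]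
        simp; ring
      rw [e]
      have h4 : 0 < ‖x‖ := hR.trans_le h
      have h6 : 0 ≤ 1 - χ x := sub_nonneg.2 χ.le_one
      rcases (χ.nonneg' x).eq_or_lt with h7 | h7
      · rw [← h7]; simp; positivity
      · have h5 := hGpos x h <| le_of_not_gt fun h8 =>
          h7.ne' (χ.zero_of_le_dist (by simpa using h8.le))
        positivity
    rw [hx, inner_zero_left] at h1
    exact h1.false

end Zeros

/-! ### Linear algebra and quadratic lower bounds -/

/-- A linear functional vanishing on the right kernel of a bilinear form is represented by it. -/
lemma exists_forall_apply_eq {K V : Type*} [Field K] [AddCommGroup V] [Module K V]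
    [FiniteDimensional K V] (B : V →ₗ[K] V →ₗ[K] K) (b : Module.Dual K V)
    (hb : ∀ φ, (∀ w, B w φ = 0) → b φ = 0) : ∃ w, ∀ φ, B w φ = b φ := by
  -- The range of a transpose is the annihilator of the kernel.
  have h : b ∈ LinearMap.range (LinearMap.dualMap B.flip) := by
    rw [LinearMap.range_dualMap_eq_dualAnnihilator_ker, Submodule.mem_dualAnnihilator]
    exact fun φ hφ => hb φ fun w => LinearMap.congr_fun (LinearMap.mem_ker.1 hφ) w
  obtain ⟨z, hz⟩ := h
  refine ⟨(Module.evalEquiv K V).symm z, fun φ => ?_⟩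
  have h := LinearMap.congr_fun hz φ
  rwa [LinearMap.dualMap_apply, ← Module.apply_evalEquiv_symm_apply] at h

section CoerciveForm

variable {V : Type*} [NormedAddCommGroup V] [InnerProductSpace ℝ V] [FiniteDimensional ℝ V]

lemma exists_pos_mul_norm_sq_le (B : V →ₗ[ℝ] V →ₗ[ℝ] ℝ) (hB : ∀ x, x ≠ 0 → 0 < B x x) :
    ∃ c > 0, ∀ x, c * ‖x‖ ^ 2 ≤ B x x := by
  have hcont : Continuous fun x => B x x := by
    have h : Continuous ((LinearMap.toContinuousLinearMap : (V →ₗ[ℝ] ℝ) ≃ₗ[ℝ] _).toLinearMap ∘ₗ B) :=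
      LinearMap.continuous_of_finiteDimensional _
    exact h.clm_apply continuous_id
  obtain ⟨c, hc, hcB⟩ := (isCompact_sphere (0 : V) 1).exists_forall_le' hcont.continuousOn (a := 0)
    fun x hx => hB x (by rintro rfl; simp at hx)
  refine ⟨c, hc, fun x => ?_⟩
  rcases eq_or_ne x 0 with rfl | hx
  · simp
  · have hx' : ‖x‖ ≠ 0 := norm_ne_zero_iff.2 hx
    have h := hcB (‖x‖⁻¹ • x) (by simp [norm_smul, hx'])
    simp only [map_smul, LinearMap.smul_apply, smul_eq_mul] at h
    calc c * ‖x‖ ^ 2 ≤ (‖x‖⁻¹ * (‖x‖⁻¹ * B x x)) * ‖x‖ ^ 2 := by gcongr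
      _ = B x x := by field_simp

/-- A continuous vector field with a positive definite quadratic lower bound, up to a linear
perturbation, vanishes somewhere. -/
lemma exists_eq_zero_of_quadratic_le [MeasurableSpace V] [BorelSpace V] {F : V → V}
    (hF : Continuous F) (B : V →ₗ[ℝ] V →ₗ[ℝ] ℝ) (hB : ∀ x, x ≠ 0 → 0 < B x x) (ℓ : V →ₗ[ℝ] ℝ)
    (hFB : ∀ x, B x x + ℓ x ≤ inner ℝ (F x) x) : ∃ x, F x = 0 := by
  obtain ⟨c, hc, hcB⟩ := exists_pos_mul_norm_sq_le B hB
  let ℓ' := LinearMap.toContinuousLinearMap ℓ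
  refine exists_eq_zero_of_inner_pos hF (R := ‖ℓ'‖ / c + 1) (by positivity) fun x hx => ?_
  refine lt_of_lt_of_le ?_ (hFB x)
  have h1 : |ℓ x| ≤ ‖ℓ'‖ * ‖x‖ := ℓ'.le_opNorm x
  have h2 := neg_le_of_abs_le h1
  have hx0 : 0 < ‖x‖ := lt_of_lt_of_le (by positivity) hx
  have h3 : ‖ℓ'‖ < c * ‖x‖ := by
    rw [mul_comm, ← div_lt_iff₀ hc]; linarith
  nlinarith [hcB x]

end CoerciveForm

/-! ### Mass and energy forms, and the elliptic projection -/

section Linear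

variable {d J : ℕ} {Ω : Set (E d)}

lemma pairing_eq_inner (v w : L2 Ω J) : pairing v w Ω = inner ℝ v w :=
  (L2.inner_def (𝕜 := ℝ) v w).symm

/-- Pointwise multiplication by a matrix on `L²(Ω; ℝ^J)`. -/
def matrixL2 (Ω : Set (E d)) (M : Matrix (Fin J) (Fin J) ℝ) : L2 Ω J →L[ℝ] L2 Ω J :=
  ContinuousLinearMap.compLpL 2 (volume.restrict Ω) (Matrix.toEuclideanCLM (𝕜 := ℝ) M)

lemma energy_eq_sum_inner (M : Matrix (Fin J) (Fin J) ℝ) (v w : H10 Ω J) :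
    energy M v w = ∑ i, inner ℝ (matrixL2 Ω M (pderiv v i)) (pderiv w i) := by
  refine Finset.sum_congr rfl fun i _ => ?_
  rw [L2.inner_def, pairing]
  refine integral_congr_ae ?_
  filter_upwards [ContinuousLinearMap.coeFn_compLpL (p := 2) (μ := volume.restrict Ω)
    (Matrix.toEuclideanCLM (𝕜 := ℝ) M) (pderiv v i)] with x hx
  rw [matrixL2, hx]

/-- The form `(M∇·, ∇·)` on `H¹₀(Ω; ℝ^J)` as a bilinear map. -/
def energyForm (Ω : Set (E d)) (M : Matrix (Fin J) (Fin J) ℝ) : H10 Ω J →ₗ[ℝ] H10 Ω J →ₗ[ℝ] ℝ :=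
  LinearMap.mk₂ ℝ (energy M)
    (fun v v' w => by
      simp_rw [energy_eq_sum_inner, ← Finset.sum_add_distrib, ← inner_add_left, ← map_add]; rfl)
    (fun c v w => by
      simp_rw [energy_eq_sum_inner, smul_eq_mul, Finset.mul_sum, ← real_inner_smul_left,
        ← map_smul]
      rfl)
    (fun v w w' => by
      simp_rw [energy_eq_sum_inner, ← Finset.sum_add_distrib, ← inner_add_right]; rfl)
    (fun c v w => by
      simp_rw [energy_eq_sum_inner, smul_eq_mul, Finset.mul_sum, ← real_inner_smul_right]; rfl)

lemma energyForm_apply (M : Matrix (Fin J) (Fin J) ℝ) (v w : H10 Ω J) :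
    energyForm Ω M v w = energy M v w := rfl

/-- The `L²` inner product on `H¹₀(Ω; ℝ^J)` as a bilinear map. -/
def massForm (Ω : Set (E d)) (J : ℕ) : H10 Ω J →ₗ[ℝ] H10 Ω J →ₗ[ℝ] ℝ :=
  (innerₗ (L2 Ω J)).compl₁₂ (LinearMap.fst ℝ _ _ ∘ₗ (H10 Ω J).subtype)
    (LinearMap.fst ℝ _ _ ∘ₗ (H10 Ω J).subtype)

lemma massForm_apply (v w : H10 Ω J) : massForm Ω J v w = inner ℝ (fn v) (fn w) := rfl

variable {M : Matrix (Fin J) (Fin J) ℝ}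

lemma inner_toEuclideanCLM_self_pos (hM : ∀ x : Fin J → ℝ, x ≠ 0 → 0 < x ⬝ᵥ (M *ᵥ x)) {y : E J}
    (hy : y ≠ 0) : 0 < inner ℝ (Matrix.toEuclideanCLM (𝕜 := ℝ) M y) y := by
  rw [EuclideanSpace.inner_eq_star_dotProduct, Matrix.ofLp_toEuclideanCLM]
  simpa using hM y.ofLp (by simpa using hy)

lemma inner_toEuclideanCLM_self_nonneg (hM : ∀ x : Fin J → ℝ, x ≠ 0 → 0 < x ⬝ᵥ (M *ᵥ x))
    (y : E J) : 0 ≤ inner ℝ (Matrix.toEuclideanCLM (𝕜 := ℝ) M y) y := by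
  rcases eq_or_ne y 0 with rfl | hy
  · simp
  · exact (inner_toEuclideanCLM_self_pos hM hy).le

lemma inner_matrixL2_self_nonneg (hM : ∀ x : Fin J → ℝ, x ≠ 0 → 0 < x ⬝ᵥ (M *ᵥ x)) (g : L2 Ω J) :
    0 ≤ inner ℝ (matrixL2 Ω M g) g := by
  rw [L2.inner_def]
  refine integral_nonneg_of_ae ?_
  filter_upwards [ContinuousLinearMap.coeFn_compLpL (p := 2) (μ := volume.restrict Ω)
    (Matrix.toEuclideanCLM (𝕜 := ℝ) M) g] with x hx
  rw [matrixL2, hx]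
  exact inner_toEuclideanCLM_self_nonneg hM _

lemma eq_zero_of_inner_matrixL2_self_eq_zero (hM : ∀ x : Fin J → ℝ, x ≠ 0 → 0 < x ⬝ᵥ (M *ᵥ x))
    {g : L2 Ω J} (hg : inner ℝ (matrixL2 Ω M g) g = 0) : g = 0 := by
  have hae := ContinuousLinearMap.coeFn_compLpL (p := 2) (μ := volume.restrict Ω)
    (Matrix.toEuclideanCLM (𝕜 := ℝ) M) g
  rw [← matrixL2] at hae
  have hint := L2.integrable_inner (𝕜 := ℝ) (matrixL2 Ω M g) g
  rw [L2.inner_def, integral_eq_zero_iff_of_nonneg_ae ?_ hint] at hg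
  · rw [Lp.eq_zero_iff_ae_eq_zero]
    filter_upwards [hae, hg] with x hx hx'
    rw [hx] at hx'
    by_contra h
    exact (inner_toEuclideanCLM_self_pos hM h).ne' hx'
  · filter_upwards [hae] with x hx
    rw [hx]
    exact inner_toEuclideanCLM_self_nonneg hM _

lemma energy_self_nonneg (hM : ∀ x : Fin J → ℝ, x ≠ 0 → 0 < x ⬝ᵥ (M *ᵥ x)) (v : H10 Ω J) :
    0 ≤ energy M v v := by
  rw [energy_eq_sum_inner]
  exact Finset.sum_nonneg fun i _ => inner_matrixL2_self_nonneg hM _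

lemma pderiv_eq_zero_of_energy_self_eq_zero (hM : ∀ x : Fin J → ℝ, x ≠ 0 → 0 < x ⬝ᵥ (M *ᵥ x))
    {v : H10 Ω J} (hv : energy M v v = 0) (i : Fin d) : pderiv v i = 0 := by
  rw [energy_eq_sum_inner, Finset.sum_eq_zero_iff_of_nonneg
    fun i _ => inner_matrixL2_self_nonneg hM _] at hv
  exact eq_zero_of_inner_matrixL2_self_eq_zero hM (hv i (Finset.mem_univ i))

/-- The energy detects the gradient component and the mass the function component, so no Poincaré
inequality is needed. -/
lemma mass_add_energy_pos (hM : ∀ x : Fin J → ℝ, x ≠ 0 → 0 < x ⬝ᵥ (M *ᵥ x)) {c : ℝ} (hc : 0 < c)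
    {v : H10 Ω J} (hv : v ≠ 0) : 0 < c * massForm Ω J v v + energyForm Ω M v v := by
  have h1 : 0 ≤ massForm Ω J v v := by
    rw [massForm_apply]; exact real_inner_self_nonneg
  have h2 : 0 ≤ energyForm Ω M v v := energy_self_nonneg hM v
  refine lt_of_le_of_ne (by positivity) fun h => hv ?_
  have h3 : energy M v v = 0 := by
    rw [← energyForm_apply]; nlinarith
  have h4 : massForm Ω J v v = 0 := by nlinarith
  rw [massForm_apply, inner_self_eq_zero] at h4
  exact Subtype.ext (Prod.ext h4 (funext (pderiv_eq_zero_of_energy_self_eq_zero hM h3)))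

/-- The elliptic projection exists. -/
lemma exists_isEllipticProjection (hM : ∀ x : Fin J → ℝ, x ≠ 0 → 0 < x ⬝ᵥ (M *ᵥ x))
    (u₀ : H10 Ω J) (Sh : Submodule ℝ (H10 Ω J)) [FiniteDimensional ℝ Sh] :
    ∃ w : Sh, IsEllipticProjection M u₀ Sh w := by
  let B : Sh →ₗ[ℝ] Sh →ₗ[ℝ] ℝ := (energyForm Ω M).compl₁₂ Sh.subtype Sh.subtype
  let b : Module.Dual ℝ Sh := (energyForm Ω M u₀) ∘ₗ Sh.subtype
  -- Definiteness is not needed: an element of the right kernel has zero energy, hence zero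
  -- gradient, and the right-hand side vanishes on it.
  obtain ⟨w, hw⟩ := exists_forall_apply_eq (V := Sh) B b fun φ hφ => by
    have h : energy M (φ : H10 Ω J) φ = 0 := hφ φ
    change energy M u₀ φ = 0
    rw [energy_eq_sum_inner]
    exact Finset.sum_eq_zero fun i _ => by
      rw [pderiv_eq_zero_of_energy_self_eq_zero hM h, inner_zero_right]
  refine ⟨w, fun φ => ?_⟩
  rw [← energyForm_apply, map_sub, LinearMap.sub_apply, sub_eq_zero]
  exact hw φ

end Linear

/-! ### Solvability of one implicit step -/

section Step

variable {d J : ℕ} {Ω : Set (E d)}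

/-- Boundedness replaces any growth condition on `f`: it puts `f(v)` in `L²`. -/
lemma ae_bounded_of_isContinuousPiecewisePolynomial (hΩ : IsOpen Ω) (hΩb : Bornology.IsBounded Ω)
    {𝒯 : Set (Set (E d))} {r : ℕ} {v : H10 Ω J} (hv : IsContinuousPiecewisePolynomial 𝒯 r v) :
    ∃ C, ∀ᵐ x ∂volume.restrict Ω, ‖fn v x‖ ≤ C := by
  obtain ⟨g, hg, -, hvg⟩ := hv
  obtain ⟨C, hC⟩ := hΩb.isCompact_closure.exists_bound_of_continuousOn hg
  refine ⟨C, ?_⟩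
  filter_upwards [hvg, ae_restrict_mem hΩ.measurableSet] with x hx hxΩ
  rw [hx]
  exact hC x (subset_closure hxΩ)

variable {f : E J → E J} {N : ℕ} {W : Type*}
  [AddCommMonoid W] [Module ℝ W] {T : W →ₗ[ℝ] L2 Ω J}

lemma coeFn_equivFun_symm (T : W →ₗ[ℝ] L2 Ω J) (φ : Module.Basis (Fin N) ℝ W) (a : Fin N → ℝ) :
    (T (φ.equivFun.symm a) : E d → E J) =ᵐ[volume.restrict Ω]
      fun x => ∑ l, a l • T (φ l) x := by
  have h : T (φ.equivFun.symm a) = ∑ l, a l • T (φ l) := by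
    simp [Module.Basis.equivFun_symm_apply, map_sum]
  rw [h]
  refine (Lp.coeFn_finsetSum _ _).trans ?_
  filter_upwards [ae_all_iff.2 fun l => Lp.coeFn_smul (a l) (T (φ l))] with x hx
  simp [Finset.sum_apply, hx]

lemma ae_bounded_of_basis {φ : Module.Basis (Fin N) ℝ W}
    (hφ : ∀ l, ∃ C, ∀ᵐ x ∂volume.restrict Ω, ‖T (φ l) x‖ ≤ C) (v : W) :
    ∃ C, ∀ᵐ x ∂volume.restrict Ω, ‖T v x‖ ≤ C := by
  choose C hC using hφ
  refine ⟨∑ l, ‖φ.equivFun v l‖ * C l, ?_⟩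
  have h := coeFn_equivFun_symm T φ (φ.equivFun v)
  rw [LinearEquiv.symm_apply_apply] at h
  filter_upwards [h, ae_all_iff.2 hC] with x hx hxC
  rw [hx]
  refine norm_sum_le_of_le _ fun l _ => ?_
  rw [norm_smul]
  gcongr
  exact hxC l

lemma memLp_comp_of_ae_bounded [IsFiniteMeasure (volume.restrict Ω)] (hf : Continuous f)
    {v : L2 Ω J} (hv : ∃ C, ∀ᵐ x ∂volume.restrict Ω, ‖v x‖ ≤ C) :
    MemLp (fun x => f (v x)) 2 (volume.restrict Ω) := by
  obtain ⟨C, hC⟩ := hv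
  obtain ⟨K, hK⟩ := (isCompact_closedBall (0 : E J) C).exists_bound_of_continuousOn hf.continuousOn
  refine MemLp.of_bound (hf.comp_aestronglyMeasurable (Lp.aestronglyMeasurable v)) K ?_
  filter_upwards [hC] with x hx
  exact hK _ (by simpa using hx)

lemma continuous_pairing_comp [IsFiniteMeasure (volume.restrict Ω)] (hf : Continuous f)
    {φ : Module.Basis (Fin N) ℝ W}
    (hφ : ∀ l, ∃ C, ∀ᵐ x ∂volume.restrict Ω, ‖T (φ l) x‖ ≤ C) (m : Fin N) :
    Continuous fun a : E N => pairing (fun x => f (T (φ.equivFun.symm a.ofLp) x))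
      (T (φ m)) Ω := by
  choose C hC using hφ
  have heq : ∀ a : E N, pairing (fun x => f (T (φ.equivFun.symm a.ofLp) x)) (T (φ m)) Ω
      = ∫ x in Ω, inner ℝ (f (∑ l, a l • T (φ l) x)) (T (φ m) x) := fun a => by
    refine integral_congr_ae ?_
    filter_upwards [coeFn_equivFun_symm T φ a.ofLp] with x hx
    rw [hx]
  simp_rw [heq]
  rw [continuous_iff_continuousAt]
  intro a₀
  -- Coefficients within distance `1` of `a₀` keep the argument of `f` in this fixed ball, which
  -- provides the dominating constant.
  obtain ⟨K, hK⟩ := (isCompact_closedBall (0 : E J)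
    (∑ l, (‖a₀‖ + 1) * C l)).exists_bound_of_continuousOn hf.continuousOn
  refine continuousAt_of_dominated (bound := fun _ => K * C m) ?_ ?_ (integrable_const _) ?_
  · refine Filter.Eventually.of_forall fun a => ?_
    refine AEStronglyMeasurable.inner (hf.comp_aestronglyMeasurable ?_) (Lp.aestronglyMeasurable _)
    exact Finset.aestronglyMeasurable_fun_sum _ fun l _ =>
      (Lp.aestronglyMeasurable _).const_smul (a l)
  · filter_upwards [Metric.ball_mem_nhds a₀ one_pos] with a ha
    filter_upwards [ae_all_iff.2 hC] with x hx
    have hbd : ‖f (∑ l, a l • T (φ l) x)‖ ≤ K := by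
      refine hK _ ?_
      rw [mem_closedBall_zero_iff]
      refine norm_sum_le_of_le _ fun l _ => ?_
      rw [norm_smul]
      have h1 : ‖a l‖ ≤ ‖a₀‖ + 1 := by
        have h2 := norm_sub_norm_le a a₀
        rw [← dist_eq_norm] at h2
        have h3 : dist a a₀ < 1 := ha
        linarith [PiLp.norm_apply_le a l]
      gcongr
      exact hx l
    calc ‖inner ℝ (f (∑ l, a l • T (φ l) x)) (T (φ m) x)‖
        ≤ ‖f (∑ l, a l • T (φ l) x)‖ * ‖T (φ m) x‖ := norm_inner_le_norm _ _
      _ ≤ K * C m := mul_le_mul hbd (hx m) (norm_nonneg _) ((norm_nonneg _).trans hbd)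
  · refine Filter.Eventually.of_forall fun x => Continuous.continuousAt ?_
    exact (hf.comp (by fun_prop)).inner continuous_const

/-- Splitting off `f 0` leaves a quadratic loss, to be absorbed by the mass term, and a linear
functional, harmless for coercivity. -/
lemma le_pairing_comp_self [IsFiniteMeasure (volume.restrict Ω)] (hf : Continuous f) {c : ℝ}
    (hfc : ∀ y, -c * ‖y‖ ^ 2 ≤ inner ℝ (f y - f 0) y) {v : L2 Ω J}
    (hv : ∃ C, ∀ᵐ x ∂volume.restrict Ω, ‖v x‖ ≤ C) :
    inner ℝ ((memLp_const (f 0)).toLp : L2 Ω J) v - c * inner ℝ v v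
      ≤ pairing (fun x => f (v x)) v Ω := by
  have h0 : ((memLp_const (f 0)).toLp : L2 Ω J) =ᵐ[volume.restrict Ω] fun _ => f 0 :=
    MemLp.coeFn_toLp _
  have h1 := (memLp_comp_of_ae_bounded hf hv).coeFn_toLp
  have hi := L2.integrable_inner (𝕜 := ℝ) (memLp_comp_of_ae_bounded hf hv).toLp v
  rw [L2.inner_def, L2.inner_def, ← integral_const_mul, ← integral_sub
    (L2.integrable_inner _ _) ((L2.integrable_inner _ _).const_mul c)]
  refine integral_mono_ae ((L2.integrable_inner _ _).sub ((L2.integrable_inner _ _).const_mul c))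
    (hi.congr ?_) ?_
  · filter_upwards [h1] with x hx
    rw [hx]
  · filter_upwards [h0] with x hx
    have := hfc (v x)
    rw [inner_sub_left] at this
    simp only [hx, real_inner_self_eq_norm_sq]
    linarith

/-- A family of linear functionals on a finite-dimensional space with a positive definite lower
bound, up to a linear perturbation, contains the zero functional. -/
lemma exists_functional_eq_zero  (φ : Module.Basis (Fin N) ℝ W) (ρ : W → W →ₗ[ℝ] ℝ)
    (hρ : ∀ l, Continuous fun a : E N => ρ (φ.equivFun.symm a.ofLp) (φ l))
    (B : W →ₗ[ℝ] W →ₗ[ℝ] ℝ) (hB : ∀ w, w ≠ 0 → 0 < B w w) (ℓ : W →ₗ[ℝ] ℝ)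
    (hρB : ∀ w, B w w + ℓ w ≤ ρ w w) : ∃ w, ρ w = 0 := by
  let y : E N ≃ₗ[ℝ] W := (WithLp.linearEquiv 2 ℝ (Fin N → ℝ)).trans φ.equivFun.symm
  -- Testing on basis vectors makes `⟨F a, a⟩ = ρ (y a) (y a)`, with no orthogonality of the basis.
  let F : E N → E N := fun a => WithLp.toLp 2 fun l => ρ (y a) (φ l)
  have hFy : ∀ a : E N, inner ℝ (F a) a = ρ (y a) (y a) := fun a => by
    have : y a = ∑ l, a l • φ l := φ.equivFun_symm_apply a.ofLp
    conv_rhs => rw [this, map_sum]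
    rw [PiLp.inner_apply, ← this]
    exact Finset.sum_congr rfl fun l _ => by
      rw [map_smul]; rfl
  have hFc : Continuous F := (PiLp.continuous_toLp 2 _).comp (continuous_pi hρ)
  obtain ⟨a, ha⟩ := exists_eq_zero_of_quadratic_le hFc (B.compl₁₂ y.toLinearMap y.toLinearMap)
    (fun a ha => hB _ ((map_ne_zero_iff y y.injective).2 ha)) (ℓ ∘ₗ y.toLinearMap)
    fun a => (hρB (y a)).trans_eq (hFy a).symm
  exact ⟨y a, φ.ext fun l => congrFun (congrArg WithLp.ofLp ha) l⟩

/-- An implicit Galerkin step for a continuous nonlinearity, with `L²` part `T`, is solvable. -/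
lemma exists_implicit_step [IsFiniteMeasure (volume.restrict Ω)] (hf : Continuous f) {c lam : ℝ}
    (hfc : ∀ y, -c * ‖y‖ ^ 2 ≤ inner ℝ (f y - f 0) y) {φ : Module.Basis (Fin N) ℝ W}
    (hφ : ∀ l, ∃ C, ∀ᵐ x ∂volume.restrict Ω, ‖T (φ l) x‖ ≤ C) (e : W →ₗ[ℝ] W →ₗ[ℝ] ℝ)
    (he : ∀ w, w ≠ 0 → 0 < (lam - c) * inner ℝ (T w) (T w) + e w w) (b : L2 Ω J) (g : W) :
    ∃ Y : W, ∀ ψ, inner ℝ (T (lam • Y + g)) (T ψ) + e Y ψ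
      + pairing (fun x => f (T Y x)) (T ψ) Ω = inner ℝ b (T ψ) := by
  -- Representing the nonlinear term by an `L²` element makes the residual linear in the test
  -- function.
  have hex : ∀ Y : W, ∃ z : L2 Ω J, ∀ w : L2 Ω J,
      pairing (fun x => f (T Y x)) w Ω = inner ℝ z w := fun Y => by
    refine ⟨(memLp_comp_of_ae_bounded hf (ae_bounded_of_basis hφ Y)).toLp, fun w => ?_⟩
    rw [L2.inner_def, pairing]
    refine integral_congr_ae ?_
    filter_upwards [(memLp_comp_of_ae_bounded hf (ae_bounded_of_basis hφ Y)).coeFn_toLp] with x hx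
    rw [hx]
  choose nl hnl using hex
  let ρ (Y : W) : W →ₗ[ℝ] ℝ := innerₗ (L2 Ω J) (T (lam • Y + g) + nl Y - b) ∘ₗ T + e Y
  have hρ : ∀ Y ψ : W, ρ Y ψ = lam * inner ℝ (T Y) (T ψ) + inner ℝ (T g) (T ψ)
      + pairing (fun x => f (T Y x)) (T ψ) Ω - inner ℝ b (T ψ) + e Y ψ := fun Y ψ => by
    rw [hnl, ← real_inner_smul_left, ← inner_add_left, ← inner_add_left, ← inner_sub_left,
      ← map_smul, ← map_add]
    rfl
  have hcont : ∀ l, Continuous fun a : E N => ρ (φ.equivFun.symm a.ofLp) (φ l) := fun l => by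
    simp_rw [hρ]
    let y : E N →ₗ[ℝ] W :=
      φ.equivFun.symm.toLinearMap ∘ₗ (WithLp.linearEquiv 2 ℝ (Fin N → ℝ)).toLinearMap
    have h1 : Continuous fun a : E N => inner ℝ (T (φ.equivFun.symm a.ofLp)) (T (φ l)) :=
      LinearMap.continuous_of_finiteDimensional (((innerₗ (L2 Ω J)).flip (T (φ l)) ∘ₗ T) ∘ₗ y)
    have h2 : Continuous fun a : E N => e (φ.equivFun.symm a.ofLp) (φ l) :=
      LinearMap.continuous_of_finiteDimensional (e.flip (φ l) ∘ₗ y)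
    exact ((((h1.const_mul lam).add continuous_const).add
      (continuous_pairing_comp hf hφ l)).sub continuous_const).add h2
  obtain ⟨Y, hY⟩ := exists_functional_eq_zero φ ρ hcont
    ((lam - c) • (innerₗ (L2 Ω J)).compl₁₂ T T + e) he
    (innerₗ (L2 Ω J) (T g - b + (memLp_const (f 0)).toLp) ∘ₗ T) fun w => by
      have h := le_pairing_comp_self hf hfc (ae_bounded_of_basis hφ w)
      change (lam - c) * inner ℝ (T w) (T w) + e w w
        + inner ℝ (T g - b + (memLp_const (f 0)).toLp) (T w) ≤ _
      rw [hρ, inner_add_left, inner_sub_left]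
      linarith
  refine ⟨Y, fun ψ => ?_⟩
  have h := hρ Y ψ
  rw [hY, LinearMap.zero_apply] at h
  rw [map_add, map_smul, inner_add_left, real_inner_smul_left]
  linarith

/-- One implicit step of the Galerkin scheme is solvable. -/
lemma exists_galerkinEq [IsFiniteMeasure (volume.restrict Ω)] {M : Matrix (Fin J) (Fin J) ℝ}
    {Sh : Submodule ℝ (H10 Ω J)}
    (hM : ∀ x : Fin J → ℝ, x ≠ 0 → 0 < x ⬝ᵥ (M *ᵥ x)) (hf : Continuous f) {c lam : ℝ}
    (hfc : ∀ y, -c * ‖y‖ ^ 2 ≤ inner ℝ (f y - f 0) y) (hlam : c < lam) (s : ℝ → L2 Ω J)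
    {φ : Module.Basis (Fin N) ℝ Sh}
    (hφ : ∀ l, ∃ C, ∀ᵐ x ∂volume.restrict Ω, ‖fn (φ l).1 x‖ ≤ C) (t : ℝ) (g : Sh) :
    ∃ Y : Sh, GalerkinEq M f s Sh t (lam • Y + g) Y := by
  obtain ⟨Y, hY⟩ := exists_implicit_step (W := Sh)
    (T := (LinearMap.fst ℝ _ _ ∘ₗ (H10 Ω J).subtype) ∘ₗ Sh.subtype) hf hfc hφ
    ((energyForm Ω M).compl₁₂ Sh.subtype Sh.subtype)
    (fun w hw => mass_add_energy_pos hM (sub_pos.2 hlam) fun h => hw (Subtype.ext h))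
    (s t) g
  refine ⟨Y, fun ψ => ?_⟩
  rw [pairing_eq_inner, pairing_eq_inner]
  exact hY ψ

end Step

/-! ### Sequences, and induction on the order -/

section Scheme

variable {d J : ℕ} {Ω : Set (E d)} {M : Matrix (Fin J) (Fin J) ℝ} {f : E J → E J} {s : ℝ → L2 Ω J}
  {u₀ : H10 Ω J} {Sh : Submodule ℝ (H10 Ω J)}

/-- Solvability of every implicit step gives a sequence with prescribed initial value. -/
lemma exists_seq_forall_step {W : Type*} [AddCommGroup W] [Module ℝ W] {P : ℕ → W → W → Prop}
    {k : ℝ} (hsolve : ∀ (n : ℕ) (g : W), ∃ z : W, P n ((2 / k) • z + g) z) (a : W) (x y : ℕ → W) :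
    ∃ u : ℕ → W, u 0 = a ∧ ∀ n, P n (fdD k u n - x n) (fdE u n - y n) := by
  have hstep : ∀ (n : ℕ) (b : W), ∃ b' : W,
      P n (k⁻¹ • (b' - b) - x n) ((2 : ℝ)⁻¹ • (b' + b) - y n) := fun n b => by
    -- The unknown is `z = (b' + b)/2 - y n`, so `b' = 2(z + y n) - b`.
    obtain ⟨z, hz⟩ := hsolve n ((2 / k) • (y n - b) - x n)
    refine ⟨(2 : ℝ) • (z + y n) - b, ?_⟩
    have h1 : k⁻¹ • ((2 : ℝ) • (z + y n) - b - b) - x n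
        = (2 / k) • z + ((2 / k) • (y n - b) - x n) := by module
    have h2 : (2 : ℝ)⁻¹ • ((2 : ℝ) • (z + y n) - b + b) - y n = z := by module
    rwa [h1, h2]
  choose next hnext using hstep
  exact ⟨fun n => Nat.rec a (fun n b => next n b) n, rfl, fun n => hnext n _⟩

lemma IsDCSolution.congr {p : ℕ} {k : ℝ} {u v : ℕ → ℕ → Sh} (h : IsDCSolution M f s u₀ Sh p k u)
    (huv : ∀ j ≤ p, u j = v j) : IsDCSolution M f s u₀ Sh p k v := by
  induction p with
  | zero => trivial
  | succ p ih =>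
    obtain ⟨h1, h2, h3, h4⟩ := h
    rw [huv _ le_rfl] at h2 h3 h4
    rw [huv p p.le_succ] at h3
    exact ⟨ih h1 fun j hj => huv j (hj.trans p.le_succ), h2, h3, h4⟩

lemma exists_next_of_isDCSolution {j : ℕ} {k : ℝ}
    (hsolve : ∀ (t : ℝ) (g : Sh), ∃ Y : Sh, GalerkinEq M f s Sh t ((2 / k) • Y + g) Y)
    (hproj : ∃ w : Sh, IsEllipticProjection M u₀ Sh w)
    (hw : ∃ w, IsDCSolution M f s u₀ Sh j (k / (2 * j + 1)) w) (v : ℕ → Sh) :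
    ∃ v' : ℕ → Sh, IsEllipticProjection M u₀ Sh (v' 0) ∧
      (∀ n, j ≤ n → MainStep M f s Sh k j v v' n) ∧
      ∃ w : ℕ → ℕ → Sh, IsDCSolution M f s u₀ Sh j (k / (2 * j + 1)) w ∧
        ∀ n, n < j → StartStep M f s Sh k j (w j) v' n := by
  obtain ⟨a, ha⟩ := hproj
  obtain ⟨w, hw⟩ := hw
  have key := fun P => exists_seq_forall_step (W := Sh) (P := P) (k := k)
  obtain ⟨v', h0, hv'⟩ := key
    (fun n => GalerkinEq M f s Sh (((n : ℝ) + 1 / 2) * k)) (fun n => hsolve _) a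
    -- Both corrections are known data, so starting and main steps form one recursion.
    (fun n => if j ≤ n then fdΛ j (fdD k v) n else fdΛBarD k j (w j) ((2 * j + 1) * n + j))
    (fun n => if j ≤ n then fdΓ j (fdE v) n else fdΓBar j (fdE (w j)) ((2 * j + 1) * n + j))
  refine ⟨v', h0 ▸ ha, fun n hn => ?_, w, hw, fun n hn => ?_⟩
  · have h := hv' n
    simp only [if_pos hn] at h
    exact h
  · have h := hv' n
    simp only [if_neg (not_le.2 hn)] at h
    exact h

/-- The induction is uniform in `k < T`, since order `p + 1` calls order `p` at both `k` and
`k/(2p+1)`. -/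
lemma exists_isDCSolution {T : ℝ}
    (hsolve : ∀ k : ℝ, 0 < k → k < T → ∀ (t : ℝ) (g : Sh),
      ∃ Y : Sh, GalerkinEq M f s Sh t ((2 / k) • Y + g) Y)
    (hproj : ∃ w : Sh, IsEllipticProjection M u₀ Sh w) (p : ℕ) :
    ∀ k : ℝ, 0 < k → k < T → ∃ u, IsDCSolution M f s u₀ Sh p k u := by
  induction p with
  | zero => exact fun _ _ _ => ⟨0, trivial⟩
  | succ p ih =>
    intro k hk hkT
    obtain ⟨u, hu⟩ := ih k hk hkT
    have hle : k / (2 * p + 1) ≤ k := div_le_self hk.le (by linarith [p.cast_nonneg (α := ℝ)])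
    obtain ⟨v', h0, h1, h2⟩ := exists_next_of_isDCSolution (hsolve k hk hkT) hproj
      (ih (k / (2 * p + 1)) (by positivity) (hle.trans_lt hkT)) (u p)
    refine ⟨Function.update u (p + 1) v', hu.congr fun j hj => ?_, ?_⟩
    · rw [Function.update_of_ne (by omega)]
    · rw [Function.update_self, Function.update_of_ne (by omega)]
      exact ⟨h0, h1, h2⟩

/-- A single family serves all orders because any preceding sequence can be extended by the next
one. -/
lemma exists_forall_isDCSolution {T : ℝ}
    (hsolve : ∀ k : ℝ, 0 < k → k < T → ∀ (t : ℝ) (g : Sh),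
      ∃ Y : Sh, GalerkinEq M f s Sh t ((2 / k) • Y + g) Y)
    (hproj : ∃ w : Sh, IsEllipticProjection M u₀ Sh w) {k : ℝ} (hk : 0 < k) (hkT : k < T) :
    ∃ u, ∀ p, IsDCSolution M f s u₀ Sh p k u := by
  have hle : ∀ p : ℕ, k / (2 * p + 1) ≤ k := fun p =>
    div_le_self hk.le (by linarith [p.cast_nonneg (α := ℝ)])
  choose next hnext using fun (p : ℕ) (v : ℕ → Sh) =>
    exists_next_of_isDCSolution (hsolve k hk hkT) hproj
      (exists_isDCSolution hsolve hproj p (k / (2 * p + 1)) (by positivity)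
        ((hle p).trans_lt hkT)) v
  -- The value at order `0` is a dummy: the corrections are empty sums for `j = 0`.
  let u : ℕ → ℕ → Sh := fun p => Nat.rec 0 (fun p v => next p v) p
  refine ⟨u, fun p => ?_⟩
  induction p with
  | zero => trivial
  | succ p ih => exact ⟨ih, hnext p (u p)⟩

end Scheme

end DCGalerkin

end

theorem theorem5 {d J : ℕ}
    (Ω : Set (DCGalerkin.E d)) (hΩ : IsOpen Ω) (hΩb : Bornology.IsBounded Ω)
    (M : Matrix (Fin J) (Fin J) ℝ) (hM : ∀ x : Fin J → ℝ, x ≠ 0 → 0 < x ⬝ᵥ (M *ᵥ x))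
    (f : DCGalerkin.E J → DCGalerkin.E J) (hf : ContDiff ℝ 1 f)
    (α q μ₀ : ℝ) (hα : 0 ≤ α) (hq : 1 ≤ q) (hμ₀ : 0 ≤ μ₀)
    (τ : DCGalerkin.E J → ℝ) (hτ : Continuous τ)
    (hmono : ∀ x y : DCGalerkin.E J,
      α * ‖x - y‖ ^ q + τ y * ‖x - y‖ ^ 2 ≤ inner ℝ (f x - f y) (x - y))
    (hdf : ∀ x y : DCGalerkin.E J, -μ₀ * ‖y‖ ^ 2 ≤ inner ℝ (fderiv ℝ f x y) y)
    (s : ℝ → DCGalerkin.L2 Ω J) (u₀ : DCGalerkin.H10 Ω J)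
    (𝒯 : Set (Set (DCGalerkin.E d))) (h𝒯 : DCGalerkin.IsMesh Ω 𝒯) (r Nh : ℕ)
    (Sh : Submodule ℝ (DCGalerkin.H10 Ω J)) (φ : Module.Basis (Fin Nh) ℝ Sh)
    (hφ : ∀ l, DCGalerkin.IsContinuousPiecewisePolynomial 𝒯 r (φ l : DCGalerkin.H10 Ω J))
    (k : ℝ) (hk : 0 < k) (hkτ : k * |τ 0| < 2) :
    ∃ u : ℕ → ℕ → Sh, ∀ j : ℕ, DCGalerkin.IsDCSolution M f s u₀ Sh j k u := by
  have : IsFiniteMeasure (volume.restrict Ω) := ⟨by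
    simpa using hΩb.measure_lt_top⟩
  have : FiniteDimensional ℝ Sh := φ.finiteDimensional_of_finite
  -- Every step below `T` satisfies the strict condition; if `τ 0 = 0` any `T > k` will do.
  obtain ⟨T, hkT, hT⟩ : ∃ T, k < T ∧ T * |τ 0| ≤ 2 := by
    rcases (abs_nonneg (τ 0)).eq_or_lt with h | h
    · exact ⟨k + 1, by linarith, by rw [← h]; norm_num⟩
    · exact ⟨2 / |τ 0|, by rwa [lt_div_iff₀ h], by rw [div_mul_cancel₀ _ h.ne']⟩
  refine DCGalerkin.exists_forall_isDCSolution (T := T) (fun k hk hkT t g => ?_)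
    (DCGalerkin.exists_isEllipticProjection hM u₀ Sh) hk hkT
  refine DCGalerkin.exists_galerkinEq (c := |τ 0|) hM hf.continuous (fun y => ?_) ?_ s (φ := φ)
    (fun l => DCGalerkin.ae_bounded_of_isContinuousPiecewisePolynomial hΩ hΩb (hφ l)) t g
  · have h := hmono y 0
    rw [sub_zero] at h
    have h1 : 0 ≤ α * ‖y‖ ^ q := by positivity
    have h2 : -|τ 0| * ‖y‖ ^ 2 ≤ τ 0 * ‖y‖ ^ 2 := by
      gcongr; exact neg_abs_le _
    linarith
  · rw [lt_div_iff₀ hk]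
    rcases (abs_nonneg (τ 0)).eq_or_lt with h | h
    · rw [← h]; norm_num
    · nlinarith
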